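/- **Setting.** A dynamic $k$-center algorithm interacts with an adaptive adversary. In each operation the adversary inserts a new point, deletes a present point, or asks for a solution for the current point set $P$. While processing an operation, the algorithm may query the adversary for distances between points inserted so far (including deleted ones). In reply to a solution request it returns a set $C$ of points inserted so far as centers; it need not report any estimate of the cost. The adversary may choose its operations and its answers depending on everything that has happened so far (but not on the internals of the algorithm). Its answers must stem from a metric whose aspect ratio is at most a number $\Delta$ that is known to the algorithm. The $k$-center cost of $C$ is $\mathrm{cost}(P,C)=\max_{p\in P}\min_{c\in C}d(p,c)$, and $\mathrm{OPT}_k(P)=\min\{\mathrm{cost}(P,C): C\subseteq P,\ |C|\le k\}$. For a function $f$, the algorithm makes *amortized at most $f(k,n)$ distance queries per operation* if at every time, against every such adversary, the number of its distance queries so far is at most the sum of $f(k,n)$ over the operations so far, $n$ being the number of current points at the beginning of the respective operation. **Theorem.** For every constant $B\ge 1$ there is a constant $c>0$, depending only on $B$, such that the following holds. Let $f(k,n)>0$ be non-decreasing in $n$ for every fixed $k$, let $k\ge 1$ and $N$ be integers with $N>Bk$, and let $\Delta\ge k$. Then there is a strategy of the adversary such that, against every dynamic algorithm that makes amortized at most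 $f(k,n)$ distance queries per operation and outputs at most $Bk$ centers, the strategy always obeys the rules above, and at some time the algorithm reports a center set $C$ for a current point set $P$ with $n=|P|\in[N,2N]$ such that for some metric of aspect ratio at most $\Delta$ that is consistent with all answers given so far, $\mathrm{OPT}_k(P)>0$ and $$\mathrm{cost}(P,C)\ \ge\ c\cdot\min\left\{k,\ \frac{\log n}{k\,\log \max\{2,f(k,2n)\}}\right\}\cdot \mathrm{OPT}_k(P).$$ In other words, the approximation factor of any such algorithm against an adaptive adversary is $\Omega\left(\min\left\{k,\frac{\log n}{k\log f(k,2n)}\right\}\right)$, where $\log f$ is read as $\log\max\{2,f\}$. -/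

import Mathlib

namespace DynKCenter

/-- Names of points. The metric on them is a separate object (a term of type `MetricSpace Point`),
unrelated to the usual distance of natural numbers. -/
abbrev Point : Type := ℕ

/-- The operations of the adversary: the two kinds of updates, and the request to report a
solution (a set of centers) for the current point set. -/
inductive Operation where
  | insert (p : Point)
  | delete (p : Point)
  | solve

/-- What can be observed of a run: the adversary issues an operation, the algorithm asks for the
distance of `p` and `q` and is told `r`, or the algorithm ends the processing of the present
operation by returning a set `C` of points. -/
inductive Event where
  | op (o : Operation)
  | answer (p q : Point) (r : ℝ)
  | output (C : Finset Point)

/-- The record of a finite part of a run, with the most recent event at the head of the list. -/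
abbrev Transcript : Type := List Event

/-- A move of the algorithm while it processes an operation: ask for a distance, or end the
processing and return a set. The set matters only if the operation is `solve`; what is returned
at the end of an update is disregarded. -/
inductive Action where
  | ask (p q : Point)
  | finish (C : Finset Point)

/-- A dynamic algorithm, with unbounded memory and computing power: its next move may be any
function of everything that it has seen so far. -/
abbrev Algorithm : Type := Transcript → Action

/-- An adaptive adversary: the next operation and the answers to the distance queries may be any
function of everything that has happened so far. -/
structure Adversary where
  nextOp : Transcript → Operation
  answer : Transcript → Point → Point → ℝ

/-- One move of the interaction: at the beginning, and whenever the algorithm has finished the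
previous operation, the adversary issues an operation; otherwise it is the algorithm's turn. -/
def step (A : Algorithm) (S : Adversary) : Transcript → Transcript
  | [] => [Event.op (S.nextOp [])]
  | Event.output C :: h => Event.op (S.nextOp (Event.output C :: h)) :: Event.output C :: h
  | e :: h =>
    match A (e :: h) with
    | Action.ask p q => Event.answer p q (S.answer (e :: h) p q) :: e :: h
    | Action.finish C => Event.output C :: e :: h

/-- The transcript after the first `m` moves. -/
def play (A : Algorithm) (S : Adversary) : ℕ → Transcript
  | 0 => []
  | m + 1 => step A S (play A S m)

/-- The points that have ever been inserted (including those deleted since). -/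
def inserted : Transcript → Finset Point
  | [] => ∅
  | Event.op (Operation.insert p) :: h => insert p (inserted h)
  | _ :: h => inserted h

/-- The current point set. -/
def current : Transcript → Finset Point
  | [] => ∅
  | Event.op (Operation.insert p) :: h => insert p (current h)
  | Event.op (Operation.delete p) :: h => (current h).erase p
  | _ :: h => current h

/-- The most recent operation. -/
def lastOp : Transcript → Option Operation
  | [] => none
  | Event.op o :: _ => some o
  | _ :: h => lastOp h

/-- The algorithm has just returned `C` in reply to a `solve` operation. -/
def Reports (h : Transcript) (C : Finset Point) : Prop :=
  ∃ h' : Transcript, h = Event.output C :: h' ∧ lastOp h' = some Operation.solve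

/-- The number of distance queries asked so far. -/
def numQueries : Transcript → ℕ
  | [] => 0
  | Event.answer _ _ _ :: h => numQueries h + 1
  | _ :: h => numQueries h

/-- The sum of `f n` over all operations so far, where `n` is the number of points at the
beginning of the respective operation. -/
noncomputable def budget (f : ℕ → ℝ) : Transcript → ℝ
  | [] => 0
  | Event.op _ :: h => budget f h + f (current h).card
  | _ :: h => budget f h

/-- Each inserted point is new, and each deleted point is present. -/
def OpsValid : Transcript → Prop
  | [] => True
  | Event.op (Operation.insert p) :: h => p ∉ inserted h ∧ OpsValid h
  | Event.op (Operation.delete p) :: h => p ∈ current h ∧ OpsValid h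
  | _ :: h => OpsValid h

/-- All answers to distance queries are the distances in the metric `M`. -/
def Consistent (M : MetricSpace Point) (h : Transcript) : Prop :=
  ∀ (p q : Point) (r : ℝ), Event.answer p q r ∈ h → r = M.dist p q

/-- The aspect ratio (largest distance over smallest distance of distinct points) of `M` is at
most `Δ`. -/
def AspectRatioLE (M : MetricSpace Point) (Δ : ℝ) : Prop :=
  ∀ p q p' q' : Point, p' ≠ q' → M.dist p q ≤ Δ * M.dist p' q'

/-- A transcript in which the adversary obeys the rules: its updates are valid, and its answers
stem from a metric of aspect ratio at most `Δ`. (Names that were never inserted impose no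
restriction: a metric on the inserted points always extends to them within the same `Δ`.) -/
def Legal (Δ : ℝ) (h : Transcript) : Prop :=
  OpsValid h ∧ ∃ M : MetricSpace Point, AspectRatioLE M Δ ∧ Consistent M h

/-- `A` is a dynamic algorithm, for metrics of aspect ratio at most `Δ`, that asks for distances
between inserted points only, that reports at most `s` points as centers, each of which was
inserted at some time (and may have been deleted since), and that asks, in the amortized sense, at
most `f n` distance queries per operation, `n` being the number of points at the beginning of the
operation. All this is against an arbitrary adaptive adversary, as long as it obeys the rules. -/
structure IsDynamicAlgorithm (A : Algorithm) (Δ s : ℝ) (f : ℕ → ℝ) : Prop where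
  ask_mem : ∀ (S : Adversary) (m : ℕ) (p q : Point) (r : ℝ) (h : Transcript),
    Legal Δ (play A S m) → play A S m = Event.answer p q r :: h →
      p ∈ inserted h ∧ q ∈ inserted h
  centers : ∀ (S : Adversary) (m : ℕ) (C : Finset Point),
    Legal Δ (play A S m) → Reports (play A S m) C →
      C ⊆ inserted (play A S m) ∧ (C.card : ℝ) ≤ s
  queries : ∀ (S : Adversary) (m : ℕ),
    Legal Δ (play A S m) → (numQueries (play A S m) : ℝ) ≤ budget f (play A S m)

/-- The `k`-center cost of the centers `C` for the point set `P`: the largest distance of a point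
of `P` to its closest center (`∞` if there is no center, but a point). -/
noncomputable def cost (M : MetricSpace Point) (P C : Finset Point) : ENNReal :=
  ⨆ p ∈ P, ⨅ c ∈ C, ENNReal.ofReal (M.dist p c)

/-- The optimal `k`-center cost of `P`, with at most `k` centers chosen from `P`. -/
noncomputable def opt (M : MetricSpace Point) (k : ℕ) (P : Finset Point) : ENNReal :=
  ⨅ C : Finset Point, ⨅ _ : C ⊆ P ∧ C.card ≤ k, cost M P C

end DynKCenter

/-! Each answer becomes an edge of a graph; the adversary commits only to the shortest path metric,
cut off at `2 * L + 1`. The more often a point is queried, the higher its stage. Depth is the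
1-Lipschitz hull of the stages, and a new edge has length depth plus depth plus one unless a path is
already as short. Since depth is 1-Lipschitz, later edges never shorten a pair that was asked
(`pathDist_cons_eq`), so all answers stay consistent.

Short edges arise only at points of low degree, so balls have bounded size, by a Catalan recursion
(`exists_ball_cover`, `ballBound_rec`). A point of positive depth lies in a ball paid for by the
queries at its center. Hence few points have positive depth (`exists_depth_cover`), and deleting
them costs fewer than `N` of the `2 * N` points. So at some time a solution is reported while all
current points have depth zero (`exists_final`).

The balls of radius `L` around the centers then miss a current point `p`. `levelDist` contracts
pairs of depth zero to distance at most one or their difference in distance layer around `p`,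
without changing any answer. One center per layer yields optimal cost at most one, but every
reported center is at distance at least `L + 1` from `p` (`exists_bad_metric`). As such a ball has
at most `F ^ (10 * L)` points, where `F = max 2 (f k (2 * N))`, the number `L` can be of order `min
k (log N / (k * log F))`. -/

namespace DynKCenter

/-! ### Stages, depths and the answering rule -/

section Answers

variable {V : Type*}

/-- The largest `j ≤ L` whose threshold `T j` does not exceed `m`. -/
def stage (L : ℕ) (T : ℕ → ℕ) (m : ℕ) : ℕ := Nat.findGreatest (fun j => T j ≤ m) L

/-- The least `1`-Lipschitz function, with respect to `d`, that is at least the stage of every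
point. -/
noncomputable def lipStage (L : ℕ) (T : ℕ → ℕ) (d : V → V → ℕ) (m : V → ℕ) (y : V) : ℕ :=
  ⨆ u, (stage L T (m u) - d u y)

/-- The shortest path distance after an edge `p q` of length `w` has been added. -/
def addEdge (d : V → V → ℕ) (p q : V) (w : ℕ) (x y : V) : ℕ :=
  min (d x y) (min (d x p + w + d q y) (d x q + w + d p y))

/-- The answer to a query for `p` and `q`, given the present distances and degrees. -/
noncomputable def reply (L : ℕ) (T : ℕ → ℕ) (d : V → V → ℕ) (m : V → ℕ) (p q : V) : ℕ :=
  min (d p q) (lipStage L T d m p + lipStage L T d m q + 1)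

/-- A metric with values in the natural numbers. -/
structure IsNatMetric (d : V → V → ℕ) : Prop where
  self : ∀ x, d x x = 0
  eq_of_zero : ∀ x y, d x y = 0 → x = y
  symm : ∀ x y, d x y = d y x
  tri : ∀ x y z, d x z ≤ d x y + d y z

variable {L : ℕ} {T : ℕ → ℕ}

theorem stage_le (m : ℕ) : stage L T m ≤ L := Nat.findGreatest_le L

theorem stage_mono {m m' : ℕ} (h : m ≤ m') : stage L T m ≤ stage L T m' :=
  Nat.findGreatest_mono (fun _ hj => le_trans hj h) le_rfl

theorem le_of_stage (hT : T 0 = 0) (m : ℕ) : T (stage L T m) ≤ m :=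
  Nat.findGreatest_spec (P := fun j => T j ≤ m) (Nat.zero_le L) (by simp [hT])

theorem lt_of_stage_lt {m i : ℕ} (hi : i ≤ L) (h : stage L T m < i) : m < T i :=
  not_le.1 (Nat.findGreatest_is_greatest (P := fun j => T j ≤ m) h hi)

theorem bddAbove_stage (d : V → V → ℕ) (m : V → ℕ) (y : V) :
    BddAbove (Set.range fun u => stage L T (m u) - d u y) := by
  refine ⟨L, ?_⟩
  rintro _ ⟨u, rfl⟩
  have := stage_le (L := L) (T := T) (m u)
  simp only
  omega

theorem le_lipStage (d : V → V → ℕ) (m : V → ℕ) (u y : V) :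
    stage L T (m u) - d u y ≤ lipStage L T d m y :=
  le_ciSup (bddAbove_stage d m y) u

theorem lipStage_le_of {d : V → V → ℕ} {m : V → ℕ} {y : V} {b : ℕ}
    (h : ∀ u, stage L T (m u) - d u y ≤ b) : lipStage L T d m y ≤ b :=
  ciSup_le' h

theorem stage_le_lipStage {d : V → V → ℕ} (hd : IsNatMetric d) (m : V → ℕ) (y : V) :
    stage L T (m y) ≤ lipStage L T d m y := by
  simpa [hd.self] using le_lipStage (L := L) (T := T) d m y y

theorem lipStage_lipschitz {d : V → V → ℕ} (hd : IsNatMetric d) (m : V → ℕ) (x y : V) :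
    lipStage L T d m x ≤ lipStage L T d m y + d x y := by
  refine lipStage_le_of fun u => ?_
  have h1 := le_lipStage (L := L) (T := T) d m u y
  have h2 := hd.tri u x y
  omega

/-- Edges only shorten distances and queries only raise degrees, so depths never decrease over time.
-/
theorem lipStage_mono {d d' : V → V → ℕ} {m m' : V → ℕ} (hd : ∀ x y, d' x y ≤ d x y)
    (hm : ∀ x, m x ≤ m' x) (y : V) : lipStage L T d m y ≤ lipStage L T d' m' y := by
  refine lipStage_le_of fun u => ?_
  have h1 := le_lipStage (L := L) (T := T) d' m' u y
  have h2 := stage_mono (L := L) (T := T) (hm u)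
  have h3 := hd u y
  omega

theorem addEdge_le (d : V → V → ℕ) (p q : V) (w : ℕ) (x y : V) : addEdge d p q w x y ≤ d x y :=
  min_le_left _ _

/-- A walk that uses the new edge twice can be shortcut to one that uses it at most once. `hw` keeps
distinct points apart. -/
theorem IsNatMetric.addEdge {d : V → V → ℕ} (hd : IsNatMetric d) {p q : V} {w : ℕ}
    (hw : w = 0 → p = q) : IsNatMetric (addEdge d p q w) where
  self x := by simp [DynKCenter.addEdge, hd.self]
  eq_of_zero x y h := by
    have h1 := hd.eq_of_zero x y
    have h2 := hd.eq_of_zero x p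
    have h3 := hd.eq_of_zero q y
    have h4 := hd.eq_of_zero x q
    have h5 := hd.eq_of_zero p y
    unfold DynKCenter.addEdge at h
    rcases Nat.eq_zero_or_pos (d x y) with h0 | h0
    · exact h1 h0
    rcases Nat.eq_zero_or_pos (d x p + w + d q y) with h6 | h6
    · rw [h2 (by omega), hw (by omega), h3 (by omega)]
    · have h7 : d x q + w + d p y = 0 := by omega
      rw [h4 (by omega), ← hw (by omega), h5 (by omega)]
  symm x y := by
    unfold DynKCenter.addEdge
    rw [hd.symm x y, hd.symm x p, hd.symm x q, hd.symm q y, hd.symm p y]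
    omega
  tri x y z := by
    have t1 := hd.tri x y z
    have t2 := hd.tri x y p
    have t3 := hd.tri x y q
    have t4 := hd.tri q y z
    have t5 := hd.tri p y z
    have t6 := hd.tri x p z
    have t7 := hd.tri x q z
    have s1 := hd.symm y p
    have s2 := hd.symm y q
    unfold DynKCenter.addEdge
    rcases min_choice (d x y) (min (d x p + w + d q y) (d x q + w + d p y)) with h | h <;>
    rcases min_choice (d y z) (min (d y p + w + d q z) (d y q + w + d p z)) with h' | h' <;>
    omega

/-! ### The path metric of the answers -/

variable [DecidableEq V]

/-- The number of pairs in the list that contain `x`. -/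
def deg (l : List (V × V)) (x : V) : ℕ := l.countP fun e => e.1 = x ∨ e.2 = x

/-- The shortest path distance of the answers to a list of queries (latest query first), cut off
at `2 * L + 1`. -/
noncomputable def pathDist (L : ℕ) (T : ℕ → ℕ) : List (V × V) → V → V → ℕ
  | [] => fun x y => if x = y then 0 else 2 * L + 1
  | e :: l => addEdge (pathDist L T l) e.1 e.2 (reply L T (pathDist L T l) (deg l) e.1 e.2)

/-- The depth of a point, after a list of queries. -/
noncomputable def depth (L : ℕ) (T : ℕ → ℕ) (l : List (V × V)) : V → ℕ :=
  lipStage L T (pathDist L T l) (deg l)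

/-- The answer to a query that follows a list of queries. -/
noncomputable def nextReply (L : ℕ) (T : ℕ → ℕ) (l : List (V × V)) (p q : V) : ℕ :=
  reply L T (pathDist L T l) (deg l) p q

theorem deg_cons (e : V × V) (l : List (V × V)) (x : V) :
    deg (e :: l) x = deg l x + if e.1 = x ∨ e.2 = x then 1 else 0 := by
  simp [deg, List.countP_cons]

theorem pathDist_cons (e : V × V) (l : List (V × V)) :
    pathDist L T (e :: l) = addEdge (pathDist L T l) e.1 e.2 (nextReply L T l e.1 e.2) := rfl

theorem nextReply_def (l : List (V × V)) (p q : V) : nextReply L T l p q =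
    min (pathDist L T l p q) (depth L T l p + depth L T l q + 1) := rfl

theorem isNatMetric_pathDist (l : List (V × V)) : IsNatMetric (pathDist L T l) := by
  induction l with
  | nil =>
    refine ⟨fun x => by simp [pathDist], fun x y h => ?_, fun x y => ?_, fun x y z => ?_⟩
    · by_contra hne
      simp [pathDist, hne] at h
    · simp [pathDist, eq_comm]
    · simp only [pathDist]
      by_cases h1 : x = y
      · subst h1; simp
      · by_cases h2 : y = z <;> simp [h1] <;> split_ifs <;> omega
  | cons e l ih =>
    rw [pathDist_cons]
    refine ih.addEdge fun h => ih.eq_of_zero _ _ ?_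
    rw [nextReply_def] at h
    omega

theorem pathDist_le (l : List (V × V)) (x y : V) : pathDist L T l x y ≤ 2 * L + 1 := by
  induction l with
  | nil => simp only [pathDist]; split_ifs <;> omega
  | cons e l ih => exact (addEdge_le _ _ _ _ _ _).trans ih

theorem pathDist_cons_le (e : V × V) (l : List (V × V)) (x y : V) :
    pathDist L T (e :: l) x y ≤ pathDist L T l x y := addEdge_le _ _ _ _ _ _

theorem depth_le_depth_cons (e : V × V) (l : List (V × V)) (x : V) :
    depth L T l x ≤ depth L T (e :: l) x :=
  lipStage_mono (pathDist_cons_le e l) (fun x => by rw [deg_cons]; omega) x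

theorem depth_lipschitz (l : List (V × V)) (x y : V) :
    depth L T l x ≤ depth L T l y + pathDist L T l x y :=
  lipStage_lipschitz (isNatMetric_pathDist l) _ x y

/-- A shortening edge has length depth plus depth plus one. As depth is 1-Lipschitz, a detour from
`u` to `v` through it costs at least the depths of `u` and `v` plus one. Asked pairs satisfy the
hypothesis, so their distance is frozen. -/
theorem pathDist_cons_eq (e : V × V) (l : List (V × V)) {u v : V}
    (h : pathDist L T l u v ≤ depth L T l u + depth L T l v + 1) :
    pathDist L T (e :: l) u v = pathDist L T l u v := by
  have hd := isNatMetric_pathDist (L := L) (T := T) l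
  have t1 := hd.tri u e.1 v
  have t2 := hd.tri e.1 e.2 v
  have t3 := hd.tri u e.2 v
  have t4 := hd.tri e.2 e.1 v
  have t5 := hd.symm e.1 e.2
  have l1 := depth_lipschitz (L := L) (T := T) l u e.1
  have l2 := depth_lipschitz (L := L) (T := T) l v e.2
  have l3 := depth_lipschitz (L := L) (T := T) l u e.2
  have l4 := depth_lipschitz (L := L) (T := T) l v e.1
  rw [hd.symm v e.2] at l2
  rw [hd.symm v e.1] at l4
  rw [pathDist_cons, addEdge, nextReply_def]
  rcases min_choice (pathDist L T l e.1 e.2) (depth L T l e.1 + depth L T l e.2 + 1) with h' | h' <;>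
  rw [h'] <;> omega

theorem pathDist_cons_self (e : V × V) (l : List (V × V)) :
    pathDist L T (e :: l) e.1 e.2 = nextReply L T l e.1 e.2 := by
  have hd := isNatMetric_pathDist (L := L) (T := T) l
  rw [pathDist_cons, addEdge, hd.self, hd.self, nextReply_def]
  omega

/-- True when the answer is given, and preserved since distances only fall and depths only rise. -/
theorem pathDist_le_of_mem {l : List (V × V)} {e : V × V} (he : e ∈ l) :
    pathDist L T l e.1 e.2 ≤ depth L T l e.1 + depth L T l e.2 + 1 := by
  induction l with
  | nil => simp at he
  | cons e' l ih =>
    have h1 := depth_le_depth_cons (L := L) (T := T) e' l e.1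
    have h2 := depth_le_depth_cons (L := L) (T := T) e' l e.2
    rcases List.mem_cons.1 he with rfl | he
    · rw [pathDist_cons_self, nextReply_def]
      omega
    · have h3 := pathDist_cons_le (L := L) (T := T) e' l e.1 e.2
      have h4 := ih he
      omega

/-! ### Size of balls and number of points of positive depth -/

/-- The points that got a shortening edge of length `i` to `x`. -/
noncomputable def shortNbrs (L : ℕ) (T : ℕ → ℕ) : List (V × V) → ℕ → V → Finset V
  | [], _, _ => ∅
  | e :: l, i, x =>
    shortNbrs L T l i x ∪
      if nextReply L T l e.1 e.2 < pathDist L T l e.1 e.2 ∧ nextReply L T l e.1 e.2 = i then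
        (if x = e.1 then {e.2} else if x = e.2 then {e.1} else ∅) else ∅

theorem shortNbrs_subset_cons (e : V × V) (l : List (V × V)) (i : ℕ) (x : V) :
    shortNbrs L T l i x ⊆ shortNbrs L T (e :: l) i x := Finset.subset_union_left

theorem mem_shortNbrs_cons {e : V × V} {l : List (V × V)}
    (h : nextReply L T l e.1 e.2 < pathDist L T l e.1 e.2) :
    e.2 ∈ shortNbrs L T (e :: l) (nextReply L T l e.1 e.2) e.1 ∧
      e.1 ∈ shortNbrs L T (e :: l) (nextReply L T l e.1 e.2) e.2 := by
  have hne : e.2 ≠ e.1 := by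
    intro h'
    rw [h', (isNatMetric_pathDist l).self] at h
    omega
  constructor
  · simp [shortNbrs, h]
  · simp [shortNbrs, h, hne]

/-- This peels the first edge off a shortest path. The default distance `2 * L + 1` need not come
from edges, hence the strict hypothesis. -/
theorem exists_first_edge (l : List (V × V)) (x y : V) (hne : x ≠ y)
    (h : pathDist L T l x y < 2 * L + 1) :
    ∃ i z, 1 ≤ i ∧ z ∈ shortNbrs L T l i x ∧
      i + pathDist L T l z y ≤ pathDist L T l x y := by
  induction l generalizing y with
  | nil => simp [pathDist, hne] at h
  | cons e l ih =>
    have hd := isNatMetric_pathDist (L := L) (T := T) l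
    by_cases hlt : pathDist L T l x y ≤ pathDist L T (e :: l) x y
    · have heq := le_antisymm (pathDist_cons_le (L := L) (T := T) e l x y) hlt
      obtain ⟨i, z, hi, hz, hle⟩ := ih y hne (by omega)
      have := pathDist_cons_le (L := L) (T := T) e l z y
      exact ⟨i, z, hi, shortNbrs_subset_cons e l i x hz, by omega⟩
    · have hcons := pathDist_cons (L := L) (T := T) e l
      have hx : pathDist L T (e :: l) x y = min (pathDist L T l x y)
          (min (pathDist L T l x e.1 + nextReply L T l e.1 e.2 + pathDist L T l e.2 y)
            (pathDist L T l x e.2 + nextReply L T l e.1 e.2 + pathDist L T l e.1 y)) := by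
        rw [hcons]; rfl
      have hpos : 1 ≤ nextReply L T l e.1 e.2 ∧
          nextReply L T l e.1 e.2 < pathDist L T l e.1 e.2 := by
        have t1 := hd.tri x e.1 y
        have t2 := hd.tri e.1 e.2 y
        have t3 := hd.tri x e.2 y
        have t4 := hd.tri e.2 e.1 y
        have t5 := hd.symm e.1 e.2
        have := nextReply_def (L := L) (T := T) l e.1 e.2
        omega
      obtain ⟨hm1, hm2⟩ := mem_shortNbrs_cons hpos.2
      have key : ∀ a b : V,
          pathDist L T (e :: l) x y =
            pathDist L T l x a + nextReply L T l e.1 e.2 + pathDist L T l b y →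
          b ∈ shortNbrs L T (e :: l) (nextReply L T l e.1 e.2) a →
          (∀ z, pathDist L T (e :: l) z y ≤
            pathDist L T l z a + nextReply L T l e.1 e.2 + pathDist L T l b y) →
          ∃ i z, 1 ≤ i ∧ z ∈ shortNbrs L T (e :: l) i x ∧
            i + pathDist L T (e :: l) z y ≤ pathDist L T (e :: l) x y := by
        intro a b hab hb hz
        -- Either the new edge itself comes first, or the old path from `x` to `a` supplies the
        -- first edge.
        by_cases hxa : x = a
        · subst hxa
          have := pathDist_cons_le (L := L) (T := T) e l b y
          exact ⟨_, b, hpos.1, hb, by omega⟩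
        · obtain ⟨i, z, hi, hz', hle⟩ := ih a hxa (by omega)
          have := hz z
          exact ⟨i, z, hi, shortNbrs_subset_cons e l i x hz', by omega⟩
      rcases le_total (pathDist L T l x e.1 + nextReply L T l e.1 e.2 + pathDist L T l e.2 y)
        (pathDist L T l x e.2 + nextReply L T l e.1 e.2 + pathDist L T l e.1 y) with hc | hc
      · refine key e.1 e.2 (by omega) hm1 fun z => ?_
        rw [hcons]
        exact (min_le_right _ _).trans (min_le_left _ _)
      · refine key e.2 e.1 (by omega) hm2 fun z => ?_
        rw [hcons]
        exact (min_le_right _ _).trans (min_le_right _ _)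

theorem card_shortNbrs_cons_le (e : V × V) (l : List (V × V)) (i : ℕ) (x : V) :
    (shortNbrs L T (e :: l) i x).card ≤
      (shortNbrs L T l i x).card + if e.1 = x ∨ e.2 = x then 1 else 0 := by
  refine (Finset.card_union_le _ _).trans (Nat.add_le_add_left ?_ _)
  split_ifs <;> simp_all

theorem card_shortNbrs_le_deg (l : List (V × V)) (i : ℕ) (x : V) :
    (shortNbrs L T l i x).card ≤ deg l x := by
  induction l with
  | nil => simp [shortNbrs]
  | cons e l ih =>
    have := card_shortNbrs_cons_le (L := L) (T := T) e l i x
    rw [deg_cons]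
    omega

/-- A shortening edge of length `i` is created only while the depth, hence the stage, of `x` is
below `i`, that is, while its degree is below `T i`. -/
theorem card_shortNbrs_le (l : List (V × V)) {i : ℕ} (hi : i ≤ L) (x : V) :
    (shortNbrs L T l i x).card ≤ T i := by
  induction l with
  | nil => simp [shortNbrs]
  | cons e l ih =>
    by_cases hc : (nextReply L T l e.1 e.2 < pathDist L T l e.1 e.2 ∧
        nextReply L T l e.1 e.2 = i) ∧ (e.1 = x ∨ e.2 = x)
    · have h1 := card_shortNbrs_le_deg (L := L) (T := T) l i x
      have h2 := card_shortNbrs_cons_le (L := L) (T := T) e l i x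
      have h3 : deg l x < T i := by
        refine lt_of_stage_lt hi ?_
        have h4 := stage_le_lipStage (L := L) (T := T)
          (isNatMetric_pathDist (L := L) (T := T) l) (deg l) x
        change _ ≤ depth L T l x at h4
        have h5 := nextReply_def (L := L) (T := T) l e.1 e.2
        rcases hc.2 with rfl | rfl <;> omega
      rw [if_pos hc.2] at h2
      omega
    · refine le_trans (Finset.card_le_card ?_) ih
      rw [shortNbrs]
      refine Finset.union_subset le_rfl ?_
      split_ifs with h1 h2 h3
      · exact absurd ⟨h1, Or.inl h2.symm⟩ hc
      · exact absurd ⟨h1, Or.inr h3.symm⟩ hc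
      · simp
      · simp

/-- A point other than `x` is reached by a first edge of some length `i + 1`, with at most `T (i +
1)` choices, and then lies in a ball of radius `r - (i + 1)`; `hN` is the resulting recursion. -/
theorem exists_ball_cover {N : ℕ → ℕ}
    (hN : ∀ r, 1 + ∑ i ∈ Finset.range r, T (i + 1) * N (r - (i + 1)) ≤ N r)
    (l : List (V × V)) (r : ℕ) (hr : r ≤ L) (x : V) :
    ∃ F : Finset V, (∀ y, pathDist L T l x y ≤ r → y ∈ F) ∧ F.card ≤ N r := by
  induction r using Nat.strong_induction_on generalizing x with
  | _ r ih =>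
    have ih' : ∀ s z, ∃ F : Finset V, s < r →
        ((∀ y, pathDist L T l z y ≤ s → y ∈ F) ∧ F.card ≤ N s) := by
      intro s z
      by_cases hs : s < r
      · obtain ⟨F, hF⟩ := ih s hs (by omega) z
        exact ⟨F, fun _ => hF⟩
      · exact ⟨∅, fun h => absurd h hs⟩
    choose F hF using ih'
    refine ⟨{x} ∪ (Finset.range r).biUnion fun i =>
      (shortNbrs L T l (i + 1) x).biUnion fun z => F (r - (i + 1)) z, fun y hy => ?_, ?_⟩
    · by_cases hxy : x = y
      · simp [hxy]
      · obtain ⟨i, z, hi, hz, hle⟩ := exists_first_edge (L := L) (T := T) l x y hxy (by omega)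
        refine Finset.mem_union_right _ (Finset.mem_biUnion.2 ⟨i - 1, ?_, ?_⟩)
        · rw [Finset.mem_range]; omega
        · rw [Nat.sub_add_cancel hi]
          exact Finset.mem_biUnion.2 ⟨z, hz, (hF (r - i) z (by omega)).1 y (by omega)⟩
    · refine ((Finset.card_union_le _ _).trans ?_).trans (hN r)
      rw [Finset.card_singleton]
      refine Nat.add_le_add_left (Finset.card_biUnion_le.trans (Finset.sum_le_sum fun i hi => ?_)) _
      rw [Finset.mem_range] at hi
      refine (Finset.card_biUnion_le_card_mul _ _ _ fun z _ => (hF _ z (by omega)).2).trans ?_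
      exact Nat.mul_le_mul_right _ (card_shortNbrs_le l (by omega) x)

theorem sum_deg_le (l : List (V × V)) (U : Finset V) : ∑ u ∈ U, deg l u ≤ 2 * l.length := by
  induction l with
  | nil => simp [deg]
  | cons e l ih =>
    simp only [deg_cons, Finset.sum_add_distrib, List.length_cons]
    have h1 : ∑ u ∈ U, (if e.1 = u ∨ e.2 = u then 1 else 0) ≤ 2 := by
      rw [← Finset.card_filter]
      refine (Finset.card_le_card (t := {e.1, e.2}) fun u hu => ?_).trans Finset.card_le_two
      rw [Finset.mem_filter] at hu
      rcases hu.2 with h | h <;> simp [h]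
    omega

theorem mem_of_deg_pos {l : List (V × V)} {u : V} (h : 0 < deg l u) :
    u ∈ (l.map Prod.fst).toFinset ∪ (l.map Prod.snd).toFinset := by
  obtain ⟨e, he, h⟩ := List.countP_pos_iff.1 h
  have h' : e.1 = u ∨ e.2 = u := by simpa using h
  rcases h' with rfl | rfl
  · exact Finset.mem_union_left _ (List.mem_toFinset.2 (List.mem_map_of_mem he))
  · exact Finset.mem_union_right _ (List.mem_toFinset.2 (List.mem_map_of_mem he))

/-- Few points have positive depth. -/
theorem exists_depth_cover {N : ℕ → ℕ} {a : ℕ} (ha : 0 < a) (hN0 : ∀ r, 0 < N r) (hT0 : T 0 = 0)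
    (hT : ∀ i, T (i + 1) = a * N i)
    (hN : ∀ r, 1 + ∑ i ∈ Finset.range r, T (i + 1) * N (r - (i + 1)) ≤ N r)
    (l : List (V × V)) :
    ∃ F : Finset V, (∀ y, 1 ≤ depth L T l y → y ∈ F) ∧ a * F.card ≤ 2 * l.length := by
  choose F hF using fun (r : ℕ) (hr : r ≤ L) (x : V) => exists_ball_cover hN l r hr x
  -- A point of positive depth is within stage minus one of some `u` of positive stage. By `hT`, `a`
  -- times the bound for that ball is the threshold of this stage, so the degree of `u` pays for it.
  let U := ((l.map Prod.fst).toFinset ∪ (l.map Prod.snd).toFinset).filter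
    fun u => 1 ≤ stage L T (deg l u)
  have hsL : ∀ u, stage L T (deg l u) - 1 ≤ L := fun u =>
    (Nat.sub_le _ _).trans (stage_le _)
  refine ⟨U.biUnion fun u => F (stage L T (deg l u) - 1) (hsL u) u, fun y hy => ?_, ?_⟩
  · have : ∃ u, 1 ≤ stage L T (deg l u) - pathDist L T l u y := by
      by_contra! hcon
      have := lipStage_le_of (L := L) (T := T) (d := pathDist L T l) (m := deg l) (y := y) (b := 0)
        (fun u => by have := hcon u; omega)
      change depth L T l y ≤ 0 at this
      omega
    obtain ⟨u, hu⟩ := this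
    have hst := le_of_stage (L := L) hT0 (deg l u)
    have hpos : 0 < deg l u := by
      refine lt_of_lt_of_le ?_ hst
      obtain ⟨j, hj⟩ : ∃ j, stage L T (deg l u) = j + 1 := ⟨stage L T (deg l u) - 1, by omega⟩
      rw [hj, hT]
      exact Nat.mul_pos ha (hN0 j)
    exact Finset.mem_biUnion.2 ⟨u, Finset.mem_filter.2 ⟨mem_of_deg_pos hpos, by omega⟩,
      (hF _ (hsL u) u).1 y (by omega)⟩
  · refine le_trans ?_ (sum_deg_le l U)
    refine (Nat.mul_le_mul_left a Finset.card_biUnion_le).trans ?_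
    rw [Finset.mul_sum]
    refine Finset.sum_le_sum fun u hu => ?_
    have h1 := (Finset.mem_filter.1 hu).2
    obtain ⟨j, hj⟩ : ∃ j, stage L T (deg l u) = j + 1 := ⟨stage L T (deg l u) - 1, by omega⟩
    refine (Nat.mul_le_mul_left a (hF _ (hsL u) u).2).trans ?_
    have hst := le_of_stage (L := L) hT0 (deg l u)
    rw [hj, hT] at hst
    rw [hj]
    exact hst

end Answers

/-! ### Catalan numbers solve the ball recursion -/

/-- The bound for the number of points in a ball. -/
def ballBound (a r : ℕ) : ℕ := catalan r * (a + 1) ^ r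

/-- The number of queries at which a point enters the respective stage. -/
def threshold (a : ℕ) : ℕ → ℕ
  | 0 => 0
  | i + 1 => a * ballBound a i

theorem catalan_pos (n : ℕ) : 0 < catalan n := by
  induction n using Nat.strong_induction_on with
  | _ n ih =>
    cases n with
    | zero => simp
    | succ n =>
      rw [catalan_succ]
      exact Finset.sum_pos (fun i _ => Nat.mul_pos (ih _ (by omega)) (ih _ (by omega))) ⟨0, by simp⟩

theorem ballBound_pos (a r : ℕ) : 0 < ballBound a r := Nat.mul_pos (catalan_pos r) (by positivity)

theorem ballBound_le (a r : ℕ) : ballBound a r ≤ (4 * (a + 1)) ^ r := by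
  rw [ballBound, mul_pow]
  refine Nat.mul_le_mul_right _ ?_
  rw [catalan_eq_centralBinom_div]
  exact (Nat.div_le_self _ _).trans (Nat.centralBinom_le_four_pow r)

/-- For radius `r + 1` the Catalan convolution sums to `a * (a + 1) ^ r * catalan (r + 1)`; the
spare factor, `a + 1` instead of `a`, absorbs the center. -/
theorem ballBound_rec (a r : ℕ) :
    1 + ∑ i ∈ Finset.range r, threshold a (i + 1) * ballBound a (r - (i + 1)) ≤ ballBound a r := by
  cases r with
  | zero => simp [ballBound]
  | succ r =>
    have h : ∑ i ∈ Finset.range (r + 1), threshold a (i + 1) * ballBound a (r + 1 - (i + 1)) =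
        a * (a + 1) ^ r * catalan (r + 1) := by
      rw [catalan_succ, ← Fin.sum_univ_eq_sum_range (fun i => threshold a (i + 1) *
        ballBound a (r + 1 - (i + 1))), Finset.mul_sum]
      refine Finset.sum_congr rfl fun i _ => ?_
      have hi : (i : ℕ) + (r - i) = r := by have := i.2; omega
      have h2 : (a + 1) ^ r = (a + 1) ^ (i : ℕ) * (a + 1) ^ (r - i) := by rw [← pow_add, hi]
      simp only [threshold, ballBound, Nat.add_sub_add_right]
      rw [h2]
      ring
    rw [h]
    have h3 : 1 ≤ catalan (r + 1) * (a + 1) ^ r := Nat.mul_pos (catalan_pos _) (by positivity)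
    rw [ballBound, pow_succ]
    nlinarith


/-! ### Metrics consistent with the answers -/

section Metric

variable {V : Type*}

/-- The metric space of a metric with values in the natural numbers. -/
noncomputable abbrev IsNatMetric.toMetricSpace {d : V → V → ℕ} (hd : IsNatMetric d) :
    MetricSpace V where
  dist x y := (d x y : ℝ)
  dist_self x := by simp [hd.self]
  dist_comm x y := by simp [hd.symm x y]
  dist_triangle x y z := by exact_mod_cast hd.tri x y z
  eq_of_dist_eq_zero {x y} h := hd.eq_of_zero x y (by exact_mod_cast h)

variable [DecidableEq V] {L : ℕ} {T : ℕ → ℕ}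

/-- The path metric, shortened as far as the depths and the Lipschitz function `φ` permit. -/
noncomputable def levelDist (L : ℕ) (T : ℕ → ℕ) (l : List (V × V)) (φ : V → ℕ) (x y : V) : ℕ :=
  min (pathDist L T l x y)
    (max (depth L T l x + depth L T l y + 1) (max (φ x - φ y) (φ y - φ x)))

/-- If one leg is a path distance, moving along it changes depth and `φ` by at most its length. If
neither is, the sum of depths plus one and the difference of `φ` each obey the triangle inequality.
-/
theorem isNatMetric_levelDist (l : List (V × V)) {φ : V → ℕ}
    (hφ : ∀ x y, φ x ≤ φ y + pathDist L T l x y) : IsNatMetric (levelDist L T l φ) := by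
  have hd := isNatMetric_pathDist (L := L) (T := T) l
  refine ⟨fun x => by simp [levelDist, hd.self], fun x y h => hd.eq_of_zero x y ?_,
    fun x y => ?_, fun x y z => ?_⟩
  · unfold levelDist at h
    omega
  · unfold levelDist
    rw [hd.symm x y]
    omega
  · have t := hd.tri x y z
    have s1 := hd.symm x y
    have s2 := hd.symm y z
    have a1 := hφ x y
    have a2 := hφ y x
    have a3 := hφ y z
    have a4 := hφ z y
    have b1 := depth_lipschitz (L := L) (T := T) l x y
    have b2 := depth_lipschitz (L := L) (T := T) l z y
    unfold levelDist
    generalize pathDist L T l x y = dxy at *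
    generalize pathDist L T l y x = dyx at *
    generalize pathDist L T l y z = dyz at *
    generalize pathDist L T l z y = dzy at *
    generalize pathDist L T l x z = dxz at *
    rcases le_total dxy (max (depth L T l x + depth L T l y + 1) (max (φ x - φ y) (φ y - φ x)))
      with h | h <;>
    rcases le_total dyz (max (depth L T l y + depth L T l z + 1) (max (φ y - φ z) (φ z - φ y)))
      with h' | h' <;>
    simp only [min_eq_left h, min_eq_right h, min_eq_left h', min_eq_right h'] <;>
    omega

/-- Asked pairs are already as short as their depths permit, so no choice of `φ` contradicts an
answer. -/
theorem levelDist_of_mem {l : List (V × V)} {e : V × V} (he : e ∈ l) (φ : V → ℕ) :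
    levelDist L T l φ e.1 e.2 = pathDist L T l e.1 e.2 := by
  have := pathDist_le_of_mem (L := L) (T := T) he
  unfold levelDist
  omega

end Metric

theorem aspectRatioLE_levelDist {L : ℕ} {T : ℕ → ℕ} {l : List (Point × Point)} {φ : Point → ℕ}
    (hφ : ∀ x y, φ x ≤ φ y + pathDist L T l x y) {Δ : ℝ} (hΔ : 2 * (L : ℝ) + 1 ≤ Δ) :
    AspectRatioLE (isNatMetric_levelDist l hφ).toMetricSpace Δ := by
  intro p q p' q' hne
  have h1 : levelDist L T l φ p q ≤ 2 * L + 1 := (min_le_left _ _).trans (pathDist_le _ _ _)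
  have h2 : 1 ≤ levelDist L T l φ p' q' := by
    by_contra! h
    exact hne ((isNatMetric_levelDist l hφ).eq_of_zero _ _ (by omega))
  change (levelDist L T l φ p q : ℝ) ≤ Δ * (levelDist L T l φ p' q' : ℝ)
  have h1' : (levelDist L T l φ p q : ℝ) ≤ 2 * (L : ℝ) + 1 := by exact_mod_cast h1
  have h2' : (1 : ℝ) ≤ (levelDist L T l φ p' q' : ℝ) := by exact_mod_cast h2
  have h3 : (0 : ℝ) ≤ L := Nat.cast_nonneg L
  nlinarith

/-! ### Bookkeeping on transcripts -/

/-- The pairs of points whose distance was asked for, the latest pair first. -/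
def askedPairs : Transcript → List (Point × Point)
  | [] => []
  | Event.answer p q _ :: h => (p, q) :: askedPairs h
  | _ :: h => askedPairs h

/-- The number of operations so far. -/
def numOps : Transcript → ℕ
  | [] => 0
  | Event.op _ :: h => numOps h + 1
  | _ :: h => numOps h

/-- The number of outputs so far. -/
def numOutputs : Transcript → ℕ
  | [] => 0
  | Event.output _ :: h => numOutputs h + 1
  | _ :: h => numOutputs h

theorem length_askedPairs (h : Transcript) : (askedPairs h).length = numQueries h := by
  induction h with
  | nil => rfl
  | cons e h ih => cases e <;> simp [askedPairs, numQueries, ih]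

theorem length_eq (h : Transcript) : h.length = numOps h + numQueries h + numOutputs h := by
  induction h with
  | nil => rfl
  | cons e h ih => cases e <;> simp [numOps, numQueries, numOutputs, ih] <;> omega

theorem current_subset_inserted (h : Transcript) : current h ⊆ inserted h := by
  induction h with
  | nil => rfl
  | cons e h ih =>
    rcases e with (p | p | _) | _ | _
    · exact Finset.insert_subset_insert p ih
    · exact (Finset.erase_subset _ _).trans ih
    all_goals exact ih

/-- It is the turn of the adversary. -/
def AtStart : Transcript → Prop
  | [] => True
  | Event.output _ :: _ => True
  | _ => False

theorem step_cases (A : Algorithm) (S : Adversary) (h : Transcript) :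
    (AtStart h ∧ step A S h = Event.op (S.nextOp h) :: h) ∨
      (¬ AtStart h ∧ ((∃ p q, step A S h = Event.answer p q (S.answer h p q) :: h) ∨
        ∃ C, step A S h = Event.output C :: h)) := by
  rcases h with _ | ⟨e, h⟩
  · exact Or.inl ⟨trivial, rfl⟩
  · rcases e with o | ⟨p, q, r⟩ | C
    · refine Or.inr ⟨id, ?_⟩
      rcases hA : A (Event.op o :: h) with ⟨p, q⟩ | C
      · exact Or.inl ⟨p, q, by simp [step, hA]⟩
      · exact Or.inr ⟨C, by simp [step, hA]⟩
    · refine Or.inr ⟨id, ?_⟩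
      rcases hA : A (Event.answer p q r :: h) with ⟨p, q⟩ | C
      · exact Or.inl ⟨p, q, by simp [step, hA]⟩
      · exact Or.inr ⟨C, by simp [step, hA]⟩
    · exact Or.inl ⟨trivial, rfl⟩

theorem length_play (A : Algorithm) (S : Adversary) (m : ℕ) : (play A S m).length = m := by
  induction m with
  | zero => rfl
  | succ m ih =>
    rcases step_cases A S (play A S m) with ⟨-, h⟩ | ⟨-, ⟨p, q, h⟩ | ⟨C, h⟩⟩ <;>
      simp [play, h, ih]

open Classical in
theorem numOutputs_add (A : Algorithm) (S : Adversary) (m : ℕ) :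
    numOutputs (play A S m) + (if AtStart (play A S m) then 0 else 1) = numOps (play A S m) := by
  induction m with
  | zero => rw [if_pos (show AtStart (play A S 0) from trivial)]; rfl
  | succ m ih =>
    rcases step_cases A S (play A S m) with ⟨h0, h⟩ | ⟨h0, ⟨p, q, h⟩ | ⟨C, h⟩⟩
    · rw [if_pos h0] at ih
      rw [play, h, if_neg (by exact id)]
      exact congrArg (· + 1) ih
    · rw [if_neg h0] at ih
      rw [play, h, if_neg (by exact id)]
      exact ih
    · rw [if_neg h0] at ih
      rw [play, h, if_pos (by trivial)]
      exact ih

theorem numOutputs_le (A : Algorithm) (S : Adversary) (m : ℕ) :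
    numOutputs (play A S m) ≤ numOps (play A S m) := by
  rw [← numOutputs_add A S m]
  exact Nat.le_add_right _ _

theorem budget_le {f : ℕ → ℝ} (hf : Monotone f) {n g : ℕ} (hg : f n ≤ g) (h : Transcript)
    (hn : (inserted h).card ≤ n) : budget f h ≤ g * numOps h := by
  induction h with
  | nil => simp [budget, numOps]
  | cons e h ih =>
    rcases e with o | _ | _
    · have hsub : inserted h ⊆ inserted (Event.op o :: h) := by
        cases o
        · exact Finset.subset_insert _ _
        all_goals exact subset_rfl
      have h1 := ih ((Finset.card_le_card hsub).trans hn)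
      have h2 : f (current h).card ≤ g := (hf ((Finset.card_le_card
        ((current_subset_inserted h).trans hsub)).trans hn)).trans hg
      simp only [budget, numOps]
      push_cast
      linarith
    · exact ih hn
    · exact ih hn

/-! ### The strategy of the adversary and its legality -/

section Strategy

variable (L : ℕ) (T : ℕ → ℕ) (N : ℕ)

open Classical in
/-- The strategy: insert `2 * N` points, then delete current points of positive depth as long as
there are any, and otherwise ask for a solution. -/
noncomputable def adversary : Adversary where
  nextOp h :=
    if (inserted h).card < 2 * N then
      Operation.insert (Infinite.exists_notMem_finset (inserted h)).choose
    else if hx : ∃ x ∈ current h, 1 ≤ depth L T (askedPairs h) x then Operation.delete hx.choose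
    else Operation.solve
  answer h p q := nextReply L T (askedPairs h) p q

theorem adversary_nextOp (h : Transcript) :
    (∃ p, (adversary L T N).nextOp h = Operation.insert p ∧ p ∉ inserted h ∧
      (inserted h).card < 2 * N) ∨
    (∃ p, (adversary L T N).nextOp h = Operation.delete p ∧ p ∈ current h ∧
      1 ≤ depth L T (askedPairs h) p) ∨
    ((adversary L T N).nextOp h = Operation.solve ∧ 2 * N ≤ (inserted h).card ∧
      ∀ x ∈ current h, depth L T (askedPairs h) x = 0) := by
  by_cases h1 : (inserted h).card < 2 * N
  · exact Or.inl ⟨_, by simp only [adversary, if_pos h1],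
      (Infinite.exists_notMem_finset (inserted h)).choose_spec, h1⟩
  · by_cases hx : ∃ x ∈ current h, 1 ≤ depth L T (askedPairs h) x
    · exact Or.inr (Or.inl ⟨_, by simp only [adversary, if_neg h1, dif_pos hx],
        hx.choose_spec⟩)
    · refine Or.inr (Or.inr ⟨by simp only [adversary, if_neg h1, dif_neg hx], not_lt.1 h1,
        fun x hx' => ?_⟩)
      by_contra h0
      exact hx ⟨x, hx', Nat.one_le_iff_ne_zero.2 h0⟩

variable {L T N} (A : Algorithm)

theorem inserted_card_le (m : ℕ) : (inserted (play A (adversary L T N) m)).card ≤ 2 * N := by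
  induction m with
  | zero => simp [play, inserted]
  | succ m ih =>
    rcases step_cases A (adversary L T N) (play A (adversary L T N) m) with
      ⟨-, h⟩ | ⟨-, ⟨p, q, h⟩ | ⟨C, h⟩⟩
    · rw [play, h]
      rcases adversary_nextOp L T N (play A (adversary L T N) m) with
        ⟨p, hp, -, hlt⟩ | ⟨p, hp, -⟩ | ⟨hp, -⟩
      · rw [hp]
        exact (Finset.card_insert_le _ _).trans hlt
      · rw [hp]; exact ih
      · rw [hp]; exact ih
    · rw [play, h]; exact ih
    · rw [play, h]; exact ih

theorem opsValid_play (m : ℕ) : OpsValid (play A (adversary L T N) m) := by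
  induction m with
  | zero => trivial
  | succ m ih =>
    rcases step_cases A (adversary L T N) (play A (adversary L T N) m) with
      ⟨-, h⟩ | ⟨-, ⟨p, q, h⟩ | ⟨C, h⟩⟩
    · rw [play, h]
      rcases adversary_nextOp L T N (play A (adversary L T N) m) with
        ⟨p, hp, hmem, -⟩ | ⟨p, hp, hmem, -⟩ | ⟨hp, -⟩
      · rw [hp]; exact ⟨hmem, ih⟩
      · rw [hp]; exact ⟨hmem, ih⟩
      · rw [hp]; exact ih
    · rw [play, h]; exact ih
    · rw [play, h]; exact ih

theorem answer_eq (m : ℕ) {p q : Point} {r : ℝ}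
    (hr : Event.answer p q r ∈ play A (adversary L T N) m) :
    (p, q) ∈ askedPairs (play A (adversary L T N) m) ∧
      r = pathDist L T (askedPairs (play A (adversary L T N) m)) p q := by
  induction m with
  | zero => simp [play] at hr
  | succ m ih =>
    rcases step_cases A (adversary L T N) (play A (adversary L T N) m) with
      ⟨-, h⟩ | ⟨-, ⟨p', q', h⟩ | ⟨C, h⟩⟩
    · rw [play, h] at hr ⊢
      exact ih (by simpa using hr)
    · rw [play, h] at hr ⊢
      simp only [askedPairs]
      rcases List.mem_cons.1 hr with heq | hr
      · obtain ⟨rfl, rfl, rfl⟩ := Event.answer.inj heq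
        exact ⟨List.mem_cons_self, by
          rw [pathDist_cons_self (p, q) (askedPairs (play A (adversary L T N) m))]; rfl⟩
      · obtain ⟨h1, h2⟩ := ih hr
        refine ⟨List.mem_cons_of_mem _ h1, ?_⟩
        rw [pathDist_cons_eq _ _ (pathDist_le_of_mem h1), h2]
    · rw [play, h] at hr ⊢
      exact ih (by simpa using hr)

theorem consistent_levelDist (m : ℕ) {φ : Point → ℕ}
    (hφ : ∀ x y, φ x ≤ φ y + pathDist L T (askedPairs (play A (adversary L T N) m)) x y) :
    Consistent (isNatMetric_levelDist _ hφ).toMetricSpace (play A (adversary L T N) m) := by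
  intro p q r hr
  obtain ⟨h1, h2⟩ := answer_eq A m hr
  rw [h2, ← levelDist_of_mem h1 φ]
  rfl

theorem legal_play {Δ : ℝ} (hΔ : 2 * (L : ℝ) + 1 ≤ Δ) (m : ℕ) :
    Legal Δ (play A (adversary L T N) m) :=
  ⟨opsValid_play A m, _, aspectRatioLE_levelDist (φ := fun _ => 0) (by simp) hΔ,
    consistent_levelDist A m (by simp)⟩

/-- Points are deleted only at positive depth, and depths never decrease. -/
theorem depth_of_deleted (m : ℕ) {x : Point}
    (hx : x ∈ inserted (play A (adversary L T N) m) \ current (play A (adversary L T N) m)) :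
    1 ≤ depth L T (askedPairs (play A (adversary L T N) m)) x := by
  induction m with
  | zero => simp [play, inserted] at hx
  | succ m ih =>
    rcases step_cases A (adversary L T N) (play A (adversary L T N) m) with
      ⟨-, h⟩ | ⟨-, ⟨p, q, h⟩ | ⟨C, h⟩⟩
    · rw [play, h] at hx ⊢
      rcases adversary_nextOp L T N (play A (adversary L T N) m) with
        ⟨p, hp, -⟩ | ⟨p, hp, -, hd⟩ | ⟨hp, -⟩
      · rw [hp] at hx ⊢
        refine ih ?_
        simp only [inserted, current, Finset.mem_sdiff, Finset.mem_insert] at hx ⊢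
        tauto
      · rw [hp] at hx ⊢
        by_cases hxp : x = p
        · subst hxp; exact hd
        · refine ih ?_
          simp only [inserted, current, Finset.mem_sdiff, Finset.mem_erase] at hx ⊢
          tauto
      · rw [hp] at hx ⊢
        exact ih hx
    · rw [play, h] at hx ⊢
      exact (ih hx).trans (depth_le_depth_cons _ _ _)
    · rw [play, h] at hx ⊢
      exact ih hx

/-- A solution was reported after which the strategy would ask for a solution again. -/
def Final (S : Adversary) (h : Transcript) : Prop :=
  (∃ C, Reports h C) ∧ S.nextOp h = Operation.solve

open Classical in
-- Before a final transcript, an update separates any two `solve` operations. The last summand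
-- counts a `solve` not yet followed by an update.
theorem numOps_le (m : ℕ) (hm : ∀ j < m, ¬ Final (adversary L T N) (play A (adversary L T N) j)) :
    numOps (play A (adversary L T N) m) ≤
      2 * ((inserted (play A (adversary L T N) m)).card +
        (inserted (play A (adversary L T N) m) \ current (play A (adversary L T N) m)).card) +
      if lastOp (play A (adversary L T N) m) = some Operation.solve then 1 else 0 := by
  induction m with
  | zero => simp [play, numOps]
  | succ m ih =>
    have ih := ih fun j hj => hm j (by omega)
    have hF := hm m (Nat.lt_succ_self m)
    rcases step_cases A (adversary L T N) (play A (adversary L T N) m) with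
      ⟨h0, h⟩ | ⟨-, ⟨p, q, h⟩ | ⟨C, h⟩⟩
    · rw [play, h]
      generalize play A (adversary L T N) m = t at *
      rcases adversary_nextOp L T N t with ⟨p, hp, hmem, -⟩ | ⟨p, hp, hmem, -⟩ | ⟨hp, -⟩
      · rw [hp]
        have h1 : (insert p (inserted t)).card = (inserted t).card + 1 :=
          Finset.card_insert_of_notMem hmem
        have h2 : insert p (inserted t) \ insert p (current t) = inserted t \ current t := by
          ext x
          simp only [Finset.mem_sdiff, Finset.mem_insert]
          by_cases hx : x = p
          · subst hx; simp [hmem]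
          · simp [hx]
        simp only [numOps, inserted, current, lastOp, h1, h2]
        simp only [Option.some.injEq, reduceCtorEq, if_false]
        split_ifs at ih <;> omega
      · rw [hp]
        have h2 : inserted t \ (current t).erase p = insert p (inserted t \ current t) := by
          ext x
          simp only [Finset.mem_sdiff, Finset.mem_insert, Finset.mem_erase]
          by_cases hx : x = p
          · subst hx; simp [current_subset_inserted t hmem]
          · simp [hx]
        have h1 : (insert p (inserted t \ current t)).card = (inserted t \ current t).card + 1 :=
          Finset.card_insert_of_notMem (by simp [hmem])
        simp only [numOps, inserted, current, lastOp, h2, h1]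
        simp only [Option.some.injEq, reduceCtorEq, if_false]
        split_ifs at ih <;> omega
      · have h1 : lastOp t ≠ some Operation.solve := by
          intro hl
          rcases t with _ | ⟨e, t⟩
          · simp [lastOp] at hl
          · rcases e with o | _ | C
            · exact h0
            · exact h0
            · exact hF ⟨⟨C, t, rfl, hl⟩, hp⟩
        rw [if_neg h1] at ih
        rw [hp]
        simp only [numOps, inserted, current, lastOp, if_true]
        omega
    · rw [play, h]; exact ih
    · rw [play, h]; exact ih

end Strategy

/-! ### Few deletions, and termination -/

section Run

variable {L N g : ℕ} {Δ s : ℝ} {f : ℕ → ℝ} {A : Algorithm}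

/-- Deletions are bounded by queries, queries by operations, and operations by insertions and
deletions. The factor 32 makes deletions at most a sixteenth of the operations, which closes this
loop below `N`. -/
theorem card_deleted_lt (hL : 2 * (L : ℝ) + 1 ≤ Δ) (hf : Monotone f) (hg0 : 0 < g)
    (hg : f (2 * N) ≤ g) (hN : 0 < N) (hA : IsDynamicAlgorithm A Δ s f) (m : ℕ)
    (hm : ∀ j < m, ¬ Final (adversary L (threshold (32 * g)) N)
      (play A (adversary L (threshold (32 * g)) N) j)) :
    (inserted (play A (adversary L (threshold (32 * g)) N) m) \
        current (play A (adversary L (threshold (32 * g)) N) m)).card < N ∧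
      numQueries (play A (adversary L (threshold (32 * g)) N) m) ≤
        g * numOps (play A (adversary L (threshold (32 * g)) N) m) ∧
      numOps (play A (adversary L (threshold (32 * g)) N) m) ≤ 6 * N + 1 := by
  have h1 := numOps_le A m hm
  have h2 := inserted_card_le (L := L) (T := threshold (32 * g)) (N := N) A m
  have h3 : numQueries (play A (adversary L (threshold (32 * g)) N) m) ≤
      g * numOps (play A (adversary L (threshold (32 * g)) N) m) := by
    have := (hA.queries _ m (legal_play A hL m)).trans (budget_le hf hg _ h2)
    exact_mod_cast this
  obtain ⟨F, hF1, hF2⟩ := exists_depth_cover (L := L) (T := threshold (32 * g))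
    (N := ballBound (32 * g)) (a := 32 * g) (by omega) (ballBound_pos _) rfl (fun _ => rfl)
    (ballBound_rec _) (askedPairs (play A (adversary L (threshold (32 * g)) N) m))
  have h4 := Finset.card_le_card fun x hx =>
    hF1 x (depth_of_deleted (L := L) (T := threshold (32 * g)) (N := N) A m hx)
  rw [length_askedPairs] at hF2
  generalize play A (adversary L (threshold (32 * g)) N) m = t at *
  have h5 : numOps t ≤ 2 * ((inserted t).card + (inserted t \ current t).card) + 1 := by
    split_ifs at h1 <;> omega
  have h6 : 32 * (inserted t \ current t).card ≤ 2 * numOps t := by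
    refine Nat.le_of_mul_le_mul_left ?_ hg0
    calc g * (32 * (inserted t \ current t).card) = 32 * g * (inserted t \ current t).card := by ring
      _ ≤ 32 * g * F.card := Nat.mul_le_mul_left _ h4
      _ ≤ 2 * numQueries t := hF2
      _ ≤ 2 * (g * numOps t) := Nat.mul_le_mul_left _ h3
      _ = g * (2 * numOps t) := by ring
  refine ⟨by omega, h3, by omega⟩

theorem exists_final (hL : 2 * (L : ℝ) + 1 ≤ Δ) (hf : Monotone f) (hg0 : 0 < g)
    (hg : f (2 * N) ≤ g) (hN : 0 < N) (hA : IsDynamicAlgorithm A Δ s f) :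
    ∃ m, Final (adversary L (threshold (32 * g)) N)
        (play A (adversary L (threshold (32 * g)) N) m) ∧
      (inserted (play A (adversary L (threshold (32 * g)) N) m) \
        current (play A (adversary L (threshold (32 * g)) N) m)).card < N := by
  classical
  by_cases hex : ∃ m, Final (adversary L (threshold (32 * g)) N)
      (play A (adversary L (threshold (32 * g)) N) m)
  · exact ⟨_, Nat.find_spec hex,
      (card_deleted_lt hL hf hg0 hg hN hA _ fun j hj => Nat.find_min hex hj).1⟩
  · exfalso
    push Not at hex
    -- One move too many: there are at most `6 * N + 1` operations, as many outputs, and `g` queries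
    -- per operation.
    set m := (g + 2) * (6 * N + 1) + 1 with hm
    obtain ⟨-, h1, h2⟩ := card_deleted_lt hL hf hg0 hg hN hA m fun j _ => hex j
    have h3 := numOutputs_le A (adversary L (threshold (32 * g)) N) m
    have h4 := length_eq (play A (adversary L (threshold (32 * g)) N) m)
    rw [length_play] at h4
    have h5 := Nat.mul_le_mul_left g h2
    rw [add_mul] at hm
    omega

end Run

/-! ### The bad metric for the reported centers -/

/-- If a function on `P` has at most `k` values, and points with the same value have distance at
most one, then `k` centers of cost at most one suffice. -/
theorem opt_le_one (M : MetricSpace Point) {k : ℕ} {P : Finset Point} (ψ : Point → ℕ)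
    (hk : (P.image ψ).card ≤ k)
    (h : ∀ x ∈ P, ∀ y ∈ P, ψ x = ψ y → M.dist x y ≤ 1) : opt M k P ≤ 1 := by
  have hch : ∀ i : ℕ, ∃ y, i ∈ P.image ψ → y ∈ P ∧ ψ y = i := fun i => by
    by_cases hi : i ∈ P.image ψ
    · obtain ⟨y, hy⟩ := Finset.mem_image.1 hi
      exact ⟨y, fun _ => hy⟩
    · exact ⟨0, fun h => absurd h hi⟩
  choose c hc using hch
  have hsub : (P.image ψ).image c ⊆ P := fun y hy => by
    obtain ⟨i, hi, rfl⟩ := Finset.mem_image.1 hy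
    exact (hc i hi).1
  refine (iInf₂_le ((P.image ψ).image c) ⟨hsub, Finset.card_image_le.trans hk⟩).trans ?_
  refine iSup₂_le fun p hp => ?_
  have hi := Finset.mem_image_of_mem ψ hp
  refine (iInf₂_le (c (ψ p)) (Finset.mem_image_of_mem c hi)).trans ?_
  rw [← ENNReal.ofReal_one]
  exact ENNReal.ofReal_le_ofReal (h p hp _ (hc _ hi).1 (hc _ hi).2.symm)

theorem le_cost (M : MetricSpace Point) {P C : Finset Point} {p : Point} (hp : p ∈ P) {r : ℝ}
    (h : ∀ c ∈ C, r ≤ M.dist p c) : ENNReal.ofReal r ≤ cost M P C :=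
  le_trans (le_iInf₂ fun c hc => ENNReal.ofReal_le_ofReal (h c hc))
    (le_iSup₂ (f := fun p _ => ⨅ c ∈ C, ENNReal.ofReal (M.dist p c)) p hp)

theorem opt_ne_zero (M : MetricSpace Point) {k : ℕ} {P : Finset Point} (hk : k < P.card)
    (h : ∀ x y, x ≠ y → 1 ≤ M.dist x y) : opt M k P ≠ 0 := by
  have : (1 : ENNReal) ≤ opt M k P := by
    refine le_iInf₂ fun C hC => ?_
    obtain ⟨p, hp, hpC⟩ := Finset.exists_mem_notMem_of_card_lt_card (hC.2.trans_lt hk)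
    rw [← ENNReal.ofReal_one]
    exact le_cost M hp fun c hc => h p c (by rintro rfl; exact hpC hc)
  intro h0
  simp [h0] at this

/-- The centers are far from some point in a metric in which few centers of cost one exist. -/
theorem exists_bad_metric {L k N g : ℕ} {Δ : ℝ} (hL : 2 * (L : ℝ) + 1 ≤ Δ) (hk : 2 * L + 1 ≤ k)
    (A : Algorithm) (m : ℕ) (C : Finset Point)
    (hP : ∀ x ∈ current (play A (adversary L (threshold (32 * g)) N) m),
      depth L (threshold (32 * g))
        (askedPairs (play A (adversary L (threshold (32 * g)) N) m)) x = 0)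
    (hkP : k < (current (play A (adversary L (threshold (32 * g)) N) m)).card)
    (hC : C.card * ballBound (32 * g) L <
      (current (play A (adversary L (threshold (32 * g)) N) m)).card) :
    ∃ M : MetricSpace Point, AspectRatioLE M Δ ∧
      Consistent M (play A (adversary L (threshold (32 * g)) N) m) ∧
      opt M k (current (play A (adversary L (threshold (32 * g)) N) m)) ≠ 0 ∧
      opt M k (current (play A (adversary L (threshold (32 * g)) N) m)) ≤ 1 ∧
      ENNReal.ofReal ((L : ℝ) + 1) ≤
        cost M (current (play A (adversary L (threshold (32 * g)) N) m)) C := by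
  set T := threshold (32 * g)
  set t := play A (adversary L T N) m
  set l := askedPairs t
  have hd := isNatMetric_pathDist (L := L) (T := T) l
  choose F hF using fun x => exists_ball_cover (L := L) (T := T) (N := ballBound (32 * g))
    (ballBound_rec _) l L le_rfl x
  obtain ⟨p, hp, hpC⟩ : ∃ p ∈ current t, p ∉ C.biUnion F :=
    Finset.exists_mem_notMem_of_card_lt_card
      ((Finset.card_biUnion_le_card_mul _ _ _ fun c _ => (hF c).2).trans_lt hC)
  have hfar : ∀ c ∈ C, L + 1 ≤ pathDist L T l p c := fun c hc => by
    by_contra! hlt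
    exact hpC (Finset.mem_biUnion.2 ⟨c, hc, (hF c).1 p (by rw [hd.symm]; omega)⟩)
  -- Layers around `p`; the cap puts all centers into layer `L + 1`.
  let φ : Point → ℕ := fun x => min (L + 1) (pathDist L T l p x)
  have hφ : ∀ x y, φ x ≤ φ y + pathDist L T l x y := fun x y => by
    have h1 := hd.tri p y x
    have h2 := hd.symm y x
    simp only [φ]
    omega
  have hone : ∀ x y, x ≠ y → 1 ≤ levelDist L T l φ x y := fun x y hne => by
    by_contra! h
    exact hne ((isNatMetric_levelDist l hφ).eq_of_zero _ _ (by omega))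
  refine ⟨(isNatMetric_levelDist l hφ).toMetricSpace, aspectRatioLE_levelDist hφ hL,
    consistent_levelDist A m hφ, opt_ne_zero _ hkP fun x y hne => ?_,
    -- Layers 0 and 1 are merged, as their points of depth zero are within distance one; `L + 1 ≤ k`
    -- classes remain.
    opt_le_one _ (fun x => max 1 (φ x)) ?_ fun x hx y hy hxy => ?_, le_cost _ hp fun c hc => ?_⟩
  · change (1 : ℝ) ≤ (levelDist L T l φ x y : ℝ)
    exact_mod_cast hone x y hne
  · refine (Finset.card_le_card (t := Finset.Icc 1 (L + 1)) fun i hi => ?_).trans ?_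
    · obtain ⟨x, -, rfl⟩ := Finset.mem_image.1 hi
      simp only [φ, Finset.mem_Icc]
      omega
    · simp only [Nat.card_Icc]
      omega
  · change (levelDist L T l φ x y : ℝ) ≤ 1
    have : levelDist L T l φ x y ≤ 1 := by
      refine (min_le_right _ _).trans ?_
      rw [hP x hx, hP y hy]
      omega
    exact_mod_cast this
  · change (L : ℝ) + 1 ≤ (levelDist L T l φ p c : ℝ)
    have h1 := hfar c hc
    have h2 : φ p = 0 := by simp [φ, hd.self]
    have h3 : φ c = L + 1 := by simp only [φ]; omega
    have : L + 1 ≤ levelDist L T l φ p c := by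
      unfold levelDist
      omega
    exact_mod_cast this


/-! ### Choice of the number of levels -/

theorem ballBound_le_pow {F : ℝ} (hF : 2 ≤ F) (r : ℕ) :
    (ballBound (32 * ⌈F⌉₊) r : ℝ) ≤ F ^ (10 * r) := by
  have h1 : (ballBound (32 * ⌈F⌉₊) r : ℝ) ≤ ((4 * (32 * ⌈F⌉₊ + 1) : ℕ) : ℝ) ^ r := by
    exact_mod_cast ballBound_le (32 * ⌈F⌉₊) r
  refine h1.trans ?_
  rw [pow_mul]
  refine pow_le_pow_left₀ (Nat.cast_nonneg _) ?_ r
  have h2 := (Nat.ceil_lt_add_one (a := F) (by linarith)).le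
  have h3 : (2 : ℝ) ^ 9 ≤ F ^ 9 := pow_le_pow_left₀ (by norm_num) hF 9
  push_cast
  calc (4 : ℝ) * (32 * (⌈F⌉₊ : ℝ) + 1) ≤ 2 ^ 9 * F := by linarith
    _ ≤ F ^ 9 * F := by gcongr
    _ = F ^ 10 := by ring

/-- The number of levels of the hard instance. -/
noncomputable def numLevels (b k N : ℕ) (F : ℝ) : ℕ :=
  min ((k - 1) / 2) ⌊Real.log (2 * N) / ((12 + b) * k * Real.log F)⌋₊

/-- The factors `2`, `B`, `k` and the ball are bounded by `F` to the powers `1`, `b`, `k` and `10 *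
L`. For `L ≥ 1` these add up to at most `(12 + b) * k * L`; for `L = 0` the bound on the ball is
one. -/
theorem numLevels_ball_lt {B F : ℝ} {b k N : ℕ} (hB : 1 ≤ B) (hb : B ≤ 2 ^ b) (hF : 2 ≤ F)
    (hk : 1 ≤ k) (hN : B * k < N) :
    B * k * ballBound (32 * ⌈F⌉₊) (numLevels b k N F) < N := by
  rcases Nat.eq_zero_or_pos (numLevels b k N F) with h0 | hpos
  · rw [h0]
    simpa [ballBound] using hN
  set L := numLevels b k N F
  have hlogF : 0 < Real.log F := Real.log_pos (by linarith)
  have hk' : (1 : ℝ) ≤ k := by exact_mod_cast hk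
  have hN0 : (0 : ℝ) < N := lt_trans (by nlinarith) hN
  have hlogN : 0 ≤ Real.log (2 * N) := by
    refine Real.log_nonneg ?_
    nlinarith
  have hL : (L : ℝ) ≤ Real.log (2 * N) / ((12 + b) * k * Real.log F) :=
    (Nat.cast_le.2 (min_le_right _ _)).trans (Nat.floor_le (by positivity))
  rw [le_div_iff₀ (by positivity)] at hL
  have hpow : F ^ ((12 + b) * k * L) ≤ 2 * N := by
    rw [← Real.log_le_log_iff (by positivity) (by positivity), Real.log_pow]
    push_cast
    linarith
  have hF1 : (1 : ℝ) ≤ F := by linarith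
  have h1 : B ≤ F ^ b := hb.trans (pow_le_pow_left₀ (by norm_num) hF b)
  have h2 : (k : ℝ) < F ^ k :=
    lt_of_lt_of_le (by exact_mod_cast Nat.lt_two_pow_self) (pow_le_pow_left₀ (by norm_num) hF k)
  have h3 := ballBound_le_pow hF L
  have hexp : 1 + b + k + 10 * L ≤ (12 + b) * k * L := by
    have e1 : 1 ≤ k * L := Nat.mul_pos hk hpos
    have e2 : k ≤ k * L := Nat.le_mul_of_pos_right k hpos
    have e3 : L ≤ k * L := Nat.le_mul_of_pos_left L hk
    have e4 : b ≤ b * (k * L) := Nat.le_mul_of_pos_right b e1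
    rw [mul_assoc, add_mul]
    omega
  have hlt : 2 * (B * k * ballBound (32 * ⌈F⌉₊) L) < 2 * N := by
    calc 2 * (B * k * ballBound (32 * ⌈F⌉₊) L) ≤ F * (F ^ b * k * F ^ (10 * L)) := by gcongr
      _ < F * (F ^ b * F ^ k * F ^ (10 * L)) := by gcongr
      _ = F ^ (1 + b + k + 10 * L) := by ring
      _ ≤ F ^ ((12 + b) * k * L) := pow_le_pow_right₀ hF1 hexp
      _ ≤ 2 * N := hpow
  linarith

/-- The cost obtained is one more than the number of levels, which makes up for rounding down. -/
theorem le_numLevels {F F' : ℝ} {b k N n : ℕ} (hF : 2 ≤ F) (hFF : F ≤ F') (hk : 1 ≤ k)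
    (hn0 : 0 < n) (hn : n ≤ 2 * N) :
    1 / (12 + b : ℝ) * min (k : ℝ) (Real.log n / (k * Real.log F')) ≤ numLevels b k N F + 1 := by
  have hlogF : 0 < Real.log F := Real.log_pos (by linarith)
  have hlogFF : Real.log F ≤ Real.log F' := Real.log_le_log (by linarith) hFF
  have hlogF0 : 0 < Real.log F' := hlogF.trans_le hlogFF
  have hk' : (1 : ℝ) ≤ k := by exact_mod_cast hk
  have hn0' : (0 : ℝ) < n := by exact_mod_cast hn0
  have hlogn : Real.log n ≤ Real.log (2 * N) := Real.log_le_log hn0' (by exact_mod_cast hn)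
  have hlogn0 : 0 ≤ Real.log n := Real.log_natCast_nonneg n
  rw [one_div_mul_eq_div, div_le_iff₀ (by positivity)]
  rcases min_choice ((k - 1) / 2) ⌊Real.log (2 * N) / ((12 + b) * k * Real.log F)⌋₊ with h | h
  · refine (min_le_left _ _).trans ?_
    have h1 : k ≤ (numLevels b k N F + 1) * (12 + b) := by
      rw [numLevels, h]
      have : k ≤ ((k - 1) / 2 + 1) * 2 := by omega
      exact this.trans (Nat.mul_le_mul_left _ (by omega))
    exact_mod_cast h1
  · refine (min_le_right _ _).trans ?_
    have h1 := (Nat.lt_floor_add_one (Real.log (2 * N) / ((12 + b) * k * Real.log F))).le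
    rw [numLevels, h]
    rw [div_le_iff₀ (by positivity)] at h1 ⊢
    refine (hlogn.trans h1).trans ?_
    calc ((⌊Real.log (2 * N) / ((12 + b) * k * Real.log F)⌋₊ : ℝ) + 1) *
          ((12 + b) * k * Real.log F)
        ≤ ((⌊Real.log (2 * N) / ((12 + b) * k * Real.log F)⌋₊ : ℝ) + 1) *
          ((12 + b) * k * Real.log F') := by gcongr
      _ = _ := by ring

end DynKCenter

theorem theorem2p6 (B : ℝ) (hB : 1 ≤ B) :
    ∃ c : ℝ, 0 < c ∧
      ∀ (f : ℕ → ℕ → ℝ), (∀ k n, 0 < f k n) → (∀ k, Monotone (f k)) →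
      ∀ (k : ℕ), 1 ≤ k → ∀ (Δ : ℝ), (k : ℝ) ≤ Δ → ∀ (N : ℕ), B * (k : ℝ) < (N : ℝ) →
      ∃ S : DynKCenter.Adversary, ∀ A : DynKCenter.Algorithm,
        DynKCenter.IsDynamicAlgorithm A Δ (B * (k : ℝ)) (f k) →
        (∀ m : ℕ, DynKCenter.Legal Δ (DynKCenter.play A S m)) ∧
        ∃ (m : ℕ) (C : Finset DynKCenter.Point) (M : MetricSpace DynKCenter.Point) (n : ℕ),
          DynKCenter.Reports (DynKCenter.play A S m) C ∧
          DynKCenter.AspectRatioLE M Δ ∧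
          DynKCenter.Consistent M (DynKCenter.play A S m) ∧
          n = (DynKCenter.current (DynKCenter.play A S m)).card ∧
          N ≤ n ∧ n ≤ 2 * N ∧
          DynKCenter.opt M k (DynKCenter.current (DynKCenter.play A S m)) ≠ 0 ∧
          ENNReal.ofReal
              (c * min (k : ℝ)
                (Real.log (n : ℝ) / ((k : ℝ) * Real.log (max 2 (f k (2 * n)))))) *
              DynKCenter.opt M k (DynKCenter.current (DynKCenter.play A S m)) ≤
            DynKCenter.cost M (DynKCenter.current (DynKCenter.play A S m)) C := by
  open DynKCenter in
  obtain ⟨b, hb⟩ := pow_unbounded_of_one_lt B (one_lt_two)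
  refine ⟨1 / (12 + b), by positivity, ?_⟩
  intro f _ hmono k hk Δ hΔ N hN
  -- The strategy must not depend on the final `n`; as `N ≤ n`, monotonicity later replaces `N` by
  -- `n`.
  set F : ℝ := max 2 (f k (2 * N))
  have hF : 2 ≤ F := le_max_left _ _
  set L := numLevels b k N F
  have hk' : (1 : ℝ) ≤ k := by exact_mod_cast hk
  have hLk : 2 * L + 1 ≤ k := by
    have : L ≤ (k - 1) / 2 := min_le_left _ _
    omega
  have hLΔ : 2 * (L : ℝ) + 1 ≤ Δ := le_trans (by exact_mod_cast hLk) hΔ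
  have hkN : k < N := by
    have : (k : ℝ) < N := lt_of_le_of_lt (by nlinarith) hN
    exact_mod_cast this
  have hg : f k (2 * N) ≤ (⌈F⌉₊ : ℝ) := (le_max_right _ _).trans (Nat.le_ceil F)
  have hg0 : 0 < ⌈F⌉₊ := Nat.ceil_pos.2 (by linarith)
  refine ⟨adversary L (threshold (32 * ⌈F⌉₊)) N, fun A hA => ⟨legal_play A hLΔ, ?_⟩⟩
  obtain ⟨m, ⟨⟨C, hC⟩, hsolve⟩, hdel⟩ :=
    exists_final hLΔ (hmono k) hg0 hg (by omega : 0 < N) hA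
  have hcard := (hA.centers _ m C (legal_play A hLΔ m) hC).2
  have hins := inserted_card_le (L := L) (T := threshold (32 * ⌈F⌉₊)) (N := N) A m
  have hsub := current_subset_inserted (play A (adversary L (threshold (32 * ⌈F⌉₊)) N) m)
  have hsdiff := Finset.card_sdiff_add_card_eq_card hsub
  -- That `solve` would come next again means that the queries of the last `solve` left no current
  -- point of positive depth.
  obtain ⟨hins', hdepth⟩ :
      2 * N ≤ (inserted (play A (adversary L (threshold (32 * ⌈F⌉₊)) N) m)).card ∧
      ∀ x ∈ current (play A (adversary L (threshold (32 * ⌈F⌉₊)) N) m),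
        depth L (threshold (32 * ⌈F⌉₊))
          (askedPairs (play A (adversary L (threshold (32 * ⌈F⌉₊)) N) m)) x = 0 := by
    rcases adversary_nextOp L (threshold (32 * ⌈F⌉₊)) N
      (play A (adversary L (threshold (32 * ⌈F⌉₊)) N) m) with ⟨p, h, -⟩ | ⟨p, h, -⟩ | ⟨-, h⟩
    · rw [h] at hsolve; cases hsolve
    · rw [h] at hsolve; cases hsolve
    · exact h
  have hNn : N ≤ (current (play A (adversary L (threshold (32 * ⌈F⌉₊)) N) m)).card := by omega
  have hball : C.card * ballBound (32 * ⌈F⌉₊) L <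
      (current (play A (adversary L (threshold (32 * ⌈F⌉₊)) N) m)).card := by
    refine lt_of_lt_of_le ?_ hNn
    have h1 := numLevels_ball_lt hB hb.le hF hk hN
    have h2 : (C.card : ℝ) * ballBound (32 * ⌈F⌉₊) L < N :=
      lt_of_le_of_lt (mul_le_mul_of_nonneg_right hcard (Nat.cast_nonneg _)) h1
    exact_mod_cast h2
  obtain ⟨M, hM1, hM2, hM3, hM4, hM5⟩ :=
    exists_bad_metric hLΔ hLk A m C hdepth (by omega) hball
  refine ⟨m, C, M, _, hC, hM1, hM2, rfl, hNn, by omega, hM3, ?_⟩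
  refine (mul_le_mul_right hM4 _).trans ?_
  rw [mul_one]
  refine (ENNReal.ofReal_le_ofReal ?_).trans hM5
  exact le_numLevels hF (max_le_max_left _ (hmono k (by omega))) hk (by omega) (by omega)
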